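/- Let $q\ge 2$ be real and let $Z_1,\dots,Z_n$ be independent real random variables with $\mathbb E[Z_i]=0$, $\mathbb E[Z_i^2]=1$ and $\mathbb E|Z_i|^q<\infty$. Let $(a_S)_{S\subseteq[n]}$ be real numbers and put $$f=\sum_{S\subseteq[n]}a_S\prod_{i\in S}Z_i,\qquad T_\rho f=\sum_{S\subseteq[n]}\rho^{|S|}a_S\prod_{i\in S}Z_i,\qquad D_Sf=\sum_{R\supseteq S}a_R\prod_{i\in R\setminus S}Z_i .$$ For positive reals $\sigma_1,\dots,\sigma_n$ write $\sigma_S=\prod_{i\in S}\sigma_i$ and $I_S[f]=\|\sigma_S^{-1}D_Sf\|_2^2$. (1) Suppose that $\sigma>0$ and $\mathbb E|Z_i|^q\le\sigma^{2-q}$ for all $i$. If $|\rho|<\frac1{2q^{3/2}}$, then $$\|T_\rho f\|_q^q\le\sum_{S\subseteq[n]}\sigma^{(2-q)|S|}\,\|D_Sf\|_2^q .$$ (2) In the setting of (1), with $\sigma_i=\sigma$ for all $i$ (so that $I_S[f]=\sigma^{-2|S|}\|D_Sf\|_2^2$), suppose that $|\rho|\le(2q)^{-3/2}$, $\beta>0$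 and $I_S[f]\le\beta\|f\|_2^2$ for all $S\subseteq[n]$. Then $\|T_\rho f\|_q\le\beta^{\frac{q-2}{2q}}\|f\|_2$. (3) Suppose that $\sigma_i>0$ and $\mathbb E|Z_i|^q\le\sigma_i^{2-q}$ for each $i$ (for instance with equality). If $|\rho|\le(2q)^{-3/2}$, then $$\|T_\rho f\|_q^q\le\sum_{S\subseteq[n]}\sigma_S^{2-q}\,\|D_Sf\|_2^q .$$ (4) In the setting of (3), suppose that $|\rho|\le(2q)^{-3/2}$, $\beta>0$ and $I_S[f]\le\beta\|f\|_2^2$ for all $S\subseteq[n]$. Then $\|T_\rho f\|_q\le\beta^{\frac{q-2}{2q}}\|f\|_2$. -/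

import Mathlib

open MeasureTheory ProbabilityTheory
open scoped ENNReal

noncomputable section

namespace GenHyper

/-- The multilinear random variable `f = ∑_S a_S ∏_{i ∈ S} Z_i`. -/
def multilin {Ω : Type*} {n : ℕ} (Z : Fin n → Ω → ℝ) (a : Finset (Fin n) → ℝ) : Ω → ℝ :=
  fun ω => ∑ S : Finset (Fin n), a S * ∏ i ∈ S, Z i ω

/-- The noise operator `T_ρ f = ∑_S ρ^|S| a_S ∏_{i ∈ S} Z_i`. -/
def noise {Ω : Type*} {n : ℕ} (ρ : ℝ) (Z : Fin n → Ω → ℝ) (a : Finset (Fin n) → ℝ) : Ω → ℝ :=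
  fun ω => ∑ S : Finset (Fin n), ρ ^ S.card * a S * ∏ i ∈ S, Z i ω

/-- The generalised derivative `D_T f = ∑_{S ⊇ T} a_S ∏_{i ∈ S \ T} Z_i`. -/
def genDeriv {Ω : Type*} {n : ℕ} (T : Finset (Fin n)) (Z : Fin n → Ω → ℝ)
    (a : Finset (Fin n) → ℝ) : Ω → ℝ :=
  fun ω => ∑ S : Finset (Fin n) with T ⊆ S, a S * ∏ i ∈ S \ T, Z i ω

/-- The generalised influence `I_S[f] = ‖σ_S⁻¹ D_S f‖₂²`, where `σ_S = ∏_{i ∈ S} σ_i`. -/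
def genInfluence {Ω : Type*} [MeasurableSpace Ω] (μ : Measure Ω) {n : ℕ} (σ : Fin n → ℝ)
    (S : Finset (Fin n)) (Z : Fin n → Ω → ℝ) (a : Finset (Fin n) → ℝ) : ℝ≥0∞ :=
  eLpNorm (fun ω => (∏ i ∈ S, σ i)⁻¹ * genDeriv S Z a ω) 2 μ ^ 2

end GenHyper

end

/-!
Absorb `ρ` into `W_i = ρ Z_i` and let the coefficients of `f` lie in a real Hilbert space `H`.
Singling out one variable, `f = X + W Y` with `W` independent of `(X, Y)`. In expectation the
linear term of the pointwise bound
`‖x + w y‖ ^ q ≤ ‖x‖ ^ q + q w ‖x‖ ^ (q - 2) ⟪x, y⟫ + 2 q² w² ‖x‖ ^ (q - 2) ‖y‖²`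
`  + ((2 q + 1) |w| ‖y‖) ^ q`
vanishes and, by Bernoulli's inequality, as soon as `4 q 𝔼[W²] ≤ 1` the first and third terms
together are at most `𝔼 ‖(X, Y)‖ ^ q` in `H ⊕ H`. One variable has been removed at the price of
doubling `H`, and induction applies to `(X, Y)` and to `Y`. Parseval identifies the resulting
energies with `‖D_S f‖₂²`, and `2 q + 1 ≤ 2 q ^ (3 / 2)` gives the stated range of `ρ`.

When the influences are small, write `T_ρ f = T_{√2 ρ} g` with `g = T_{1 / √2} f`. Bounding
`‖D_S g‖₂ ^ (q - 2)` by the influence of `S` leaves `∑_S ‖D_S g‖₂²`, which equals `‖f‖₂²`.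
-/

namespace GenHyper

open scoped RealInnerProductSpace

section RealInequalities

variable {q x y : ℝ}

theorem sq_rpow_half (hx : 0 ≤ x) : (x ^ 2) ^ (q / 2) = x ^ q := by
  rw [← Real.rpow_natCast_mul hx, Nat.cast_ofNat, mul_div_cancel₀ q two_ne_zero]

theorem rpow_sub_two_mul_sq (hq : 0 < q) (hx : 0 ≤ x) : x ^ (q - 2) * x ^ 2 = x ^ q := by
  rw [← Real.rpow_natCast x 2, Nat.cast_ofNat, ← Real.rpow_add' hx (by simpa using hq.ne'),
    sub_add_cancel]

theorem rpow_sub_two_mul_le_add_rpow {z : ℝ} (hq : 2 ≤ q) (hx : 0 ≤ x) (hy : 0 ≤ y)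
    (hz : z ≤ (x + y) ^ 2) : x ^ (q - 2) * z ≤ (x + y) ^ q := by
  calc x ^ (q - 2) * z ≤ x ^ (q - 2) * (x + y) ^ 2 := by gcongr
    _ ≤ (x + y) ^ (q - 2) * (x + y) ^ 2 := by
        gcongr; exact le_add_of_nonneg_right hy
    _ = (x + y) ^ q := rpow_sub_two_mul_sq (by linarith) (add_nonneg hx hy)

theorem one_add_rpow_le_of_abs_mul_le_one {p u : ℝ} (hp : 0 ≤ p) (hu : -1 ≤ u)
    (hpu : |p * u| ≤ 1) : (1 + u) ^ p ≤ 1 + p * u + (p * u) ^ 2 := by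
  have hexp : Real.exp (p * u) - 1 - p * u ≤ (p * u) ^ 2 :=
    (le_abs_self _).trans (Real.abs_exp_sub_one_sub_id_le hpu)
  calc (1 + u) ^ p ≤ Real.exp u ^ p := by
        gcongr
        · linarith
        · linarith [Real.add_one_le_exp u]
    _ = Real.exp (p * u) := by rw [← Real.exp_mul, mul_comm]
    _ ≤ 1 + p * u + (p * u) ^ 2 := by linarith

theorem rpow_add_mul_sq_le_sq_add_sq_rpow (hq : 2 ≤ q) (hx : 0 ≤ x) :
    x ^ q + q / 2 * (x ^ (q - 2) * y ^ 2) ≤ (x ^ 2 + y ^ 2) ^ (q / 2) := by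
  rcases hx.eq_or_lt with rfl | hx
  · rcases hq.eq_or_lt with rfl | hq
    · norm_num
    · rw [Real.zero_rpow (by linarith), Real.zero_rpow (by linarith)]
      simp only [zero_mul, mul_zero, add_zero]
      positivity
  · have bernoulli : 1 + q / 2 * (y / x) ^ 2 ≤ (1 + (y / x) ^ 2) ^ (q / 2) :=
      one_add_mul_self_le_rpow_one_add (by linarith [sq_nonneg (y / x)]) (by linarith)
    calc x ^ q + q / 2 * (x ^ (q - 2) * y ^ 2) = x ^ q * (1 + q / 2 * (y / x) ^ 2) := by
          rw [← rpow_sub_two_mul_sq (by linarith) hx.le]; field_simp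
      _ ≤ (x ^ 2) ^ (q / 2) * (1 + (y / x) ^ 2) ^ (q / 2) := by
          rw [sq_rpow_half hx.le]; gcongr
      _ = (x ^ 2 + y ^ 2) ^ (q / 2) := by
          rw [← Real.mul_rpow (by positivity) (by positivity)]; congr 1; field_simp

theorem two_mul_add_one_le_two_mul_rpow (hq : 2 ≤ q) : 2 * q + 1 ≤ 2 * q ^ (3 / 2 : ℝ) := by
  refine le_of_sq_le_sq ?_ (by positivity)
  have hcube : (q ^ (3 / 2 : ℝ)) ^ 2 = q ^ 3 := by
    rw [← Real.rpow_mul_natCast (by linarith), ← Real.rpow_natCast]; norm_num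
  rw [mul_pow, hcube]
  nlinarith [mul_nonneg (sub_nonneg.2 hq) (sq_nonneg q), sq_nonneg (q - 2)]

theorem rpow_two_sub_mul_rpow_half_le {w B t : ℝ} (hq : 2 ≤ q) (hw : 0 ≤ w) (ht : 0 < t)
    (hB : 0 ≤ B) (h : w ≤ B * t ^ 2) : t ^ (2 - q) * w ^ (q / 2) ≤ B ^ ((q - 2) / 2) * w := by
  have hsplit : w ^ (q / 2) = w ^ ((q - 2) / 2) * w := by
    rw [← Real.rpow_add_one' hw (by linarith)]; congr 1; ring
  calc t ^ (2 - q) * w ^ (q / 2) ≤ t ^ (2 - q) * ((B * t ^ 2) ^ ((q - 2) / 2) * w) := by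
        rw [hsplit]
        gcongr
    _ = t ^ (2 - q) * t ^ (q - 2) * (B ^ ((q - 2) / 2) * w) := by
        rw [Real.mul_rpow hB (by positivity), sq_rpow_half ht.le]; ring
    _ = B ^ ((q - 2) / 2) * w := by
        rw [← Real.rpow_add ht, sub_add_sub_cancel, sub_self, Real.rpow_zero, one_mul]

end RealInequalities

section InnerProductSpace

variable {H : Type*} [NormedAddCommGroup H] {q : ℝ}

theorem norm_rpow_add_mul_sq_le_norm_toLp_rpow (hq : 2 ≤ q) (x y : H) :
    ‖x‖ ^ q + q / 2 * (‖x‖ ^ (q - 2) * ‖y‖ ^ 2) ≤ ‖WithLp.toLp 2 (x, y)‖ ^ q := by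
  rw [← sq_rpow_half (norm_nonneg (WithLp.toLp 2 (x, y))), WithLp.prod_norm_sq_eq_of_L2]
  exact rpow_add_mul_sq_le_sq_add_sq_rpow hq (norm_nonneg x)

variable [InnerProductSpace ℝ H]

theorem abs_two_mul_inner_add_norm_sq_le {x v : H} (hv : 4 * ‖v‖ ≤ ‖x‖) :
    |2 * ⟪x, v⟫ + ‖v‖ ^ 2| ≤ 9 / 4 * (‖x‖ * ‖v‖) := by
  have hinner := abs_le.1 (abs_real_inner_le_norm x v)
  rw [abs_le]
  constructor <;> nlinarith [norm_nonneg v]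

theorem norm_add_rpow_le_of_two_mul_norm_lt (hq : 2 ≤ q) {x v : H} (hv : 2 * q * ‖v‖ < ‖x‖) :
    ‖x + v‖ ^ q ≤ ‖x‖ ^ q + q * (‖x‖ ^ (q - 2) * ⟪x, v⟫) +
      2 * q ^ 2 * (‖x‖ ^ (q - 2) * ‖v‖ ^ 2) := by
  have hx : 0 < ‖x‖ := lt_of_le_of_lt (by positivity) hv
  set d := 2 * ⟪x, v⟫ + ‖v‖ ^ 2 with hd
  have hd_abs : |d| ≤ 9 / 4 * (‖x‖ * ‖v‖) :=
    abs_two_mul_inner_add_norm_sq_le (by nlinarith [norm_nonneg v])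
  have hd_sq : d ^ 2 / ‖x‖ ^ 2 ≤ 81 / 16 * ‖v‖ ^ 2 := by
    rw [div_le_iff₀ (by positivity)]
    linarith [sq_le_sq' (abs_le.1 hd_abs).1 (abs_le.1 hd_abs).2]
  have hsq : ‖x + v‖ ^ 2 = ‖x‖ ^ 2 * (1 + d / ‖x‖ ^ 2) := by
    rw [norm_add_sq_real, hd]; field_simp; ring
  have hfactor : 0 ≤ 1 + d / ‖x‖ ^ 2 :=
    nonneg_of_mul_nonneg_right (hsq ▸ sq_nonneg ‖x + v‖) (by positivity)
  have hsmall : |q / 2 * (d / ‖x‖ ^ 2)| ≤ 1 := by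
    rw [← mul_div_assoc, abs_div, abs_sq, div_le_one (by positivity), abs_mul,
      abs_of_nonneg (by positivity)]
    nlinarith [norm_nonneg v]
  have hbracket : q / 2 * d + q ^ 2 / 4 * (d ^ 2 / ‖x‖ ^ 2) ≤
      q * ⟪x, v⟫ + 2 * q ^ 2 * ‖v‖ ^ 2 := by
    nlinarith [mul_le_mul_of_nonneg_left hd_sq (sq_nonneg q), sq_nonneg ‖v‖,
      mul_nonneg (by nlinarith : 0 ≤ q ^ 2 - q) (sq_nonneg ‖v‖)]
  calc ‖x + v‖ ^ q = ‖x‖ ^ q * (1 + d / ‖x‖ ^ 2) ^ (q / 2) := by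
        rw [← sq_rpow_half (norm_nonneg _), hsq, Real.mul_rpow (by positivity) hfactor,
          sq_rpow_half hx.le]
    _ ≤ ‖x‖ ^ q * (1 + q / 2 * (d / ‖x‖ ^ 2) + (q / 2 * (d / ‖x‖ ^ 2)) ^ 2) := by
        gcongr
        exact one_add_rpow_le_of_abs_mul_le_one (by linarith) (by linarith) hsmall
    _ = ‖x‖ ^ q + ‖x‖ ^ (q - 2) * (q / 2 * d + q ^ 2 / 4 * (d ^ 2 / ‖x‖ ^ 2)) := by
        rw [← rpow_sub_two_mul_sq (by linarith) hx.le]; field_simp; ring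
    _ ≤ ‖x‖ ^ q + ‖x‖ ^ (q - 2) * (q * ⟪x, v⟫ + 2 * q ^ 2 * ‖v‖ ^ 2) := by gcongr
    _ = _ := by ring

theorem norm_rpow_add_inner_add_sq_nonneg (hq : 0 < q) (x v : H) :
    0 ≤ ‖x‖ ^ q + q * (‖x‖ ^ (q - 2) * ⟪x, v⟫) + 2 * q ^ 2 * (‖x‖ ^ (q - 2) * ‖v‖ ^ 2) := by
  have hquad : 0 ≤ ‖x‖ ^ 2 + q * ⟪x, v⟫ + 2 * q ^ 2 * ‖v‖ ^ 2 := by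
    nlinarith [(abs_le.1 (abs_real_inner_le_norm x v)).1, sq_nonneg (‖x‖ - q * ‖v‖),
      sq_nonneg ‖x‖, sq_nonneg (q * ‖v‖)]
  calc 0 ≤ ‖x‖ ^ (q - 2) * (‖x‖ ^ 2 + q * ⟪x, v⟫ + 2 * q ^ 2 * ‖v‖ ^ 2) := by positivity
    _ = _ := by rw [← rpow_sub_two_mul_sq hq (norm_nonneg x)]; ring

theorem norm_add_rpow_le (hq : 2 ≤ q) (x v : H) :
    ‖x + v‖ ^ q ≤ ‖x‖ ^ q + q * (‖x‖ ^ (q - 2) * ⟪x, v⟫) +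
      2 * q ^ 2 * (‖x‖ ^ (q - 2) * ‖v‖ ^ 2) + (2 * q + 1) ^ q * ‖v‖ ^ q := by
  rcases lt_or_ge (2 * q * ‖v‖) ‖x‖ with hv | hv
  · exact le_add_of_le_of_nonneg (norm_add_rpow_le_of_two_mul_norm_lt hq hv) (by positivity)
  · calc ‖x + v‖ ^ q ≤ ((2 * q + 1) * ‖v‖) ^ q := by
          gcongr
          linarith [norm_add_le x v]
      _ = (2 * q + 1) ^ q * ‖v‖ ^ q := Real.mul_rpow (by positivity) (norm_nonneg v)
      _ ≤ _ := le_add_of_nonneg_left (norm_rpow_add_inner_add_sq_nonneg (by linarith) x v)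

theorem norm_add_smul_rpow_le (hq : 2 ≤ q) (w : ℝ) (x y : H) :
    ‖x + w • y‖ ^ q ≤ ‖x‖ ^ q + q * (w * (‖x‖ ^ (q - 2) * ⟪x, y⟫)) +
      2 * q ^ 2 * (w ^ 2 * (‖x‖ ^ (q - 2) * ‖y‖ ^ 2)) +
      (2 * q + 1) ^ q * (|w| ^ q * ‖y‖ ^ q) := by
  refine (norm_add_rpow_le hq x (w • y)).trans_eq ?_
  rw [inner_smul_right, norm_smul, Real.norm_eq_abs, mul_pow, sq_abs,
    Real.mul_rpow (abs_nonneg w) (norm_nonneg y)]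
  ring

end InnerProductSpace

section OneStep

variable {Ω : Type*} {m mΩ : MeasurableSpace Ω} {μ : Measure Ω} {q : ℝ}

theorem integrable_norm_rpow {E : Type*} [NormedAddCommGroup E] (hq : 0 < q) {X : Ω → E}
    (hX : MemLp X (ENNReal.ofReal q) μ) : Integrable (fun ω => ‖X ω‖ ^ q) μ := by
  simpa only [ENNReal.toReal_ofReal hq.le] using
    hX.integrable_norm_rpow (ENNReal.ofReal_pos.2 hq).ne' ENNReal.ofReal_ne_top

theorem memLp_two_of_two_le [IsFiniteMeasure μ] {E : Type*} [NormedAddCommGroup E] (hq : 2 ≤ q)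
    {X : Ω → E} (hX : MemLp X (ENNReal.ofReal q) μ) : MemLp X 2 μ :=
  hX.mono_exponent (by simpa using ENNReal.ofReal_le_ofReal hq)

theorem indepFun_of_indep_comap {W Y : Ω → ℝ} (hind : Indep (.comap W inferInstance) m μ)
    (hY : Measurable[m] Y) : IndepFun W Y μ :=
  indep_of_indep_of_le_right hind hY.comap_le

variable {H : Type*} [NormedAddCommGroup H] {W : Ω → ℝ} {X Y : Ω → H}

theorem integrable_of_norm_le_add_rpow (hq : 0 < q) (hX : MemLp X (ENNReal.ofReal q) μ)
    (hY : MemLp Y (ENNReal.ofReal q) μ) {g : Ω → ℝ} (hg : AEStronglyMeasurable g μ)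
    (hle : ∀ ω, ‖g ω‖ ≤ (‖X ω‖ + ‖Y ω‖) ^ q) : Integrable g μ := by
  refine (integrable_norm_rpow hq (hX.norm.add hY.norm)).mono' hg (ae_of_all _ fun ω => ?_)
  simpa only [Pi.add_apply, Real.norm_of_nonneg (add_nonneg (norm_nonneg _) (norm_nonneg _))]
    using hle ω

theorem aestronglyMeasurable_norm_rpow_sub_two (hq : 2 ≤ q) (hX : AEStronglyMeasurable X μ) :
    AEStronglyMeasurable (fun ω => ‖X ω‖ ^ (q - 2)) μ :=
  (Real.continuous_rpow_const (sub_nonneg.2 hq)).comp_aestronglyMeasurable hX.norm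

theorem integrable_norm_rpow_mul_norm_sq (hq : 2 ≤ q) (hX : MemLp X (ENNReal.ofReal q) μ)
    (hY : MemLp Y (ENNReal.ofReal q) μ) :
    Integrable (fun ω => ‖X ω‖ ^ (q - 2) * ‖Y ω‖ ^ 2) μ := by
  refine integrable_of_norm_le_add_rpow (by linarith) hX hY
    ((aestronglyMeasurable_norm_rpow_sub_two hq hX.1).mul (hY.1.norm.pow 2)) fun ω => ?_
  rw [Real.norm_of_nonneg (by positivity)]
  refine rpow_sub_two_mul_le_add_rpow hq (norm_nonneg _) (norm_nonneg _) ?_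
  gcongr
  exact le_add_of_nonneg_left (norm_nonneg _)

theorem memLp_smul_of_indep [NormedSpace ℝ H] (hq : 0 < q)
    (hind : Indep (.comap W inferInstance) m μ) (hYm : StronglyMeasurable[m] Y)
    (hW : MemLp W (ENNReal.ofReal q) μ) (hY : MemLp Y (ENNReal.ofReal q) μ) :
    MemLp (fun ω => W ω • Y ω) (ENNReal.ofReal q) μ := by
  have hind_rpow : IndepFun (fun ω => ‖W ω‖ ^ q) (fun ω => ‖Y ω‖ ^ q) μ :=
    (indepFun_of_indep_comap hind hYm.norm.measurable).comp
      (φ := fun w => ‖w‖ ^ q) (ψ := fun y => y ^ q) (by fun_prop) (by fun_prop)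
  refine (integrable_norm_rpow_iff (f := fun ω => W ω • Y ω) (hW.1.smul hY.1)
    (ENNReal.ofReal_pos.2 hq).ne' ENNReal.ofReal_ne_top).1 ?_
  simp only [ENNReal.toReal_ofReal hq.le, norm_smul, Real.mul_rpow (norm_nonneg _) (norm_nonneg _)]
  exact hind_rpow.integrable_mul (integrable_norm_rpow hq hW) (integrable_norm_rpow hq hY)

variable [InnerProductSpace ℝ H]

theorem integrable_norm_rpow_mul_inner (hq : 2 ≤ q) (hX : MemLp X (ENNReal.ofReal q) μ)
    (hY : MemLp Y (ENNReal.ofReal q) μ) :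
    Integrable (fun ω => ‖X ω‖ ^ (q - 2) * ⟪X ω, Y ω⟫) μ := by
  refine integrable_of_norm_le_add_rpow (by linarith) hX hY
    ((aestronglyMeasurable_norm_rpow_sub_two hq hX.1).mul (hX.1.inner hY.1)) fun ω => ?_
  rw [norm_mul, Real.norm_of_nonneg (by positivity), Real.norm_eq_abs]
  refine rpow_sub_two_mul_le_add_rpow hq (norm_nonneg _) (norm_nonneg _) ?_
  nlinarith [abs_real_inner_le_norm (X ω) (Y ω), norm_nonneg (X ω), norm_nonneg (Y ω)]

variable [IsFiniteMeasure μ]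

theorem integral_norm_add_smul_sq (hind : Indep (.comap W inferInstance) m μ)
    (hXm : StronglyMeasurable[m] X) (hYm : StronglyMeasurable[m] Y)
    (hW : MemLp W 2 μ) (hX : MemLp X 2 μ) (hY : MemLp Y 2 μ) (hmean : ∫ ω, W ω ∂μ = 0) :
    ∫ ω, ‖X ω + W ω • Y ω‖ ^ 2 ∂μ =
      ∫ ω, ‖X ω‖ ^ 2 ∂μ + (∫ ω, W ω ^ 2 ∂μ) * ∫ ω, ‖Y ω‖ ^ 2 ∂μ := by
  have hinner : Integrable (fun ω => ⟪X ω, Y ω⟫) μ :=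
    (hX.norm.integrable_mul hY.norm).mono' (hX.1.inner hY.1)
      (ae_of_all _ fun ω => abs_real_inner_le_norm (X ω) (Y ω))
  have hind₁ : IndepFun W (fun ω => ⟪X ω, Y ω⟫) μ :=
    indepFun_of_indep_comap hind (hXm.inner hYm).measurable
  have hind₂ : IndepFun (fun ω => W ω ^ 2) (fun ω => ‖Y ω‖ ^ 2) μ :=
    (indepFun_of_indep_comap hind hYm.norm.measurable).comp
      (φ := fun w => w ^ 2) (ψ := fun y => y ^ 2) (by fun_prop) (by fun_prop)
  have hint₁ : Integrable (fun ω => 2 * (W ω * ⟪X ω, Y ω⟫)) μ :=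
    (hind₁.integrable_mul (hW.integrable one_le_two) hinner).const_mul 2
  have hint₂ : Integrable (fun ω => W ω ^ 2 * ‖Y ω‖ ^ 2) μ :=
    hind₂.integrable_mul hW.integrable_sq hY.norm.integrable_sq
  have hexpand (ω : Ω) : ‖X ω + W ω • Y ω‖ ^ 2 =
      ‖X ω‖ ^ 2 + 2 * (W ω * ⟪X ω, Y ω⟫) + W ω ^ 2 * ‖Y ω‖ ^ 2 := by
    rw [norm_add_sq_real, inner_smul_right, norm_smul, mul_pow, Real.norm_eq_abs, sq_abs]
  have hcross : ∫ ω, W ω * ⟪X ω, Y ω⟫ ∂μ = 0 := by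
    rw [hind₁.integral_fun_mul_eq_mul_integral hW.1 hinner.1, hmean, zero_mul]
  simp only [hexpand]
  rw [integral_add (by exact hX.norm.integrable_sq.add hint₁) hint₂,
    integral_add hX.norm.integrable_sq hint₁, integral_const_mul, hcross, mul_zero, add_zero,
    hind₂.integral_fun_mul_eq_mul_integral hW.integrable_sq.1 hY.norm.integrable_sq.1]

theorem integral_norm_add_smul_rpow_le (hq : 2 ≤ q)
    (hind : Indep (.comap W inferInstance) m μ)
    (hXm : StronglyMeasurable[m] X) (hYm : StronglyMeasurable[m] Y)
    (hW : MemLp W (ENNReal.ofReal q) μ) (hX : MemLp X (ENNReal.ofReal q) μ)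
    (hY : MemLp Y (ENNReal.ofReal q) μ) (hmean : ∫ ω, W ω ∂μ = 0) :
    ∫ ω, ‖X ω + W ω • Y ω‖ ^ q ∂μ ≤ ∫ ω, ‖X ω‖ ^ q ∂μ +
      2 * q ^ 2 * ((∫ ω, W ω ^ 2 ∂μ) * ∫ ω, ‖X ω‖ ^ (q - 2) * ‖Y ω‖ ^ 2 ∂μ) +
      (2 * q + 1) ^ q * ((∫ ω, |W ω| ^ q ∂μ) * ∫ ω, ‖Y ω‖ ^ q ∂μ) := by
  have hq₀ : 0 < q := by linarith
  have hW₂ : MemLp W 2 μ := memLp_two_of_two_le hq hW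
  have hWq : Integrable (fun ω => |W ω| ^ q) μ := integrable_norm_rpow hq₀ hW
  have hXq := integrable_norm_rpow hq₀ hX
  have hYq := integrable_norm_rpow hq₀ hY
  have hinner := integrable_norm_rpow_mul_inner hq hX hY
  have hsq := integrable_norm_rpow_mul_norm_sq hq hX hY
  have hXm' : Measurable[m] fun ω => ‖X ω‖ ^ (q - 2) := hXm.norm.measurable.pow_const _
  have hind₁ : IndepFun W (fun ω => ‖X ω‖ ^ (q - 2) * ⟪X ω, Y ω⟫) μ :=
    indepFun_of_indep_comap hind (hXm'.mul (hXm.inner hYm).measurable)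
  have hind₂ : IndepFun (fun ω => W ω ^ 2) (fun ω => ‖X ω‖ ^ (q - 2) * ‖Y ω‖ ^ 2) μ :=
    (indepFun_of_indep_comap hind (hXm'.mul (hYm.norm.measurable.pow_const 2))).comp
      (φ := fun w => w ^ 2) (by fun_prop) measurable_id
  have hind₃ : IndepFun (fun ω => |W ω| ^ q) (fun ω => ‖Y ω‖ ^ q) μ :=
    (indepFun_of_indep_comap hind (hYm.norm.measurable.pow_const q)).comp
      (φ := fun w => |w| ^ q) (by fun_prop) measurable_id
  have hint₁ : Integrable (fun ω => q * (W ω * (‖X ω‖ ^ (q - 2) * ⟪X ω, Y ω⟫))) μ :=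
    (hind₁.integrable_mul (hW₂.integrable one_le_two) hinner).const_mul q
  have hint₂ : Integrable
      (fun ω => 2 * q ^ 2 * (W ω ^ 2 * (‖X ω‖ ^ (q - 2) * ‖Y ω‖ ^ 2))) μ :=
    (hind₂.integrable_mul hW₂.integrable_sq hsq).const_mul (2 * q ^ 2)
  have hint₃ : Integrable (fun ω => (2 * q + 1) ^ q * (|W ω| ^ q * ‖Y ω‖ ^ q)) μ :=
    (hind₃.integrable_mul hWq hYq).const_mul ((2 * q + 1) ^ q)
  have hcross : ∫ ω, W ω * (‖X ω‖ ^ (q - 2) * ⟪X ω, Y ω⟫) ∂μ = 0 := by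
    rw [hind₁.integral_fun_mul_eq_mul_integral hW.1 hinner.1, hmean, zero_mul]
  refine (integral_mono_of_nonneg (ae_of_all _ fun ω => by positivity)
    (((hXq.add hint₁).add hint₂).add hint₃)
    (ae_of_all _ fun ω => norm_add_smul_rpow_le hq (W ω) (X ω) (Y ω))).trans_eq ?_
  simp only [Pi.add_apply]
  rw [integral_add (by exact (hXq.add hint₁).add hint₂) hint₃,
    integral_add (by exact hXq.add hint₁) hint₂,
    integral_add hXq hint₁, integral_const_mul, hcross, mul_zero, add_zero, integral_const_mul,
    hind₂.integral_fun_mul_eq_mul_integral hW₂.integrable_sq.1 hsq.1, integral_const_mul,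
    hind₃.integral_fun_mul_eq_mul_integral hWq.1 hYq.1]

theorem integral_norm_add_smul_rpow_le_toLp {M : ℝ} (hq : 2 ≤ q)
    (hind : Indep (.comap W inferInstance) m μ)
    (hXm : StronglyMeasurable[m] X) (hYm : StronglyMeasurable[m] Y)
    (hW : MemLp W (ENNReal.ofReal q) μ) (hX : MemLp X (ENNReal.ofReal q) μ)
    (hY : MemLp Y (ENNReal.ofReal q) μ) (hmean : ∫ ω, W ω ∂μ = 0)
    (hvar : 4 * q * ∫ ω, W ω ^ 2 ∂μ ≤ 1) (hM : (2 * q + 1) ^ q * ∫ ω, |W ω| ^ q ∂μ ≤ M) :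
    ∫ ω, ‖X ω + W ω • Y ω‖ ^ q ∂μ ≤
      ∫ ω, ‖WithLp.toLp 2 (X ω, Y ω)‖ ^ q ∂μ + M * ∫ ω, ‖Y ω‖ ^ q ∂μ := by
  have hq₀ : 0 < q := by linarith
  have hXq := integrable_norm_rpow hq₀ hX
  have hsq := integrable_norm_rpow_mul_norm_sq hq hX hY
  have hXYq : Integrable (fun ω => ‖WithLp.toLp 2 (X ω, Y ω)‖ ^ q) μ :=
    integrable_norm_rpow hq₀ (MemLp.of_fst_of_snd_prodLp ⟨hX, hY⟩)
  have hcoeff : 2 * q ^ 2 * ∫ ω, W ω ^ 2 ∂μ ≤ q / 2 := by nlinarith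
  calc ∫ ω, ‖X ω + W ω • Y ω‖ ^ q ∂μ
      ≤ ∫ ω, ‖X ω‖ ^ q ∂μ +
          2 * q ^ 2 * ((∫ ω, W ω ^ 2 ∂μ) * ∫ ω, ‖X ω‖ ^ (q - 2) * ‖Y ω‖ ^ 2 ∂μ) +
          (2 * q + 1) ^ q * ((∫ ω, |W ω| ^ q ∂μ) * ∫ ω, ‖Y ω‖ ^ q ∂μ) :=
        integral_norm_add_smul_rpow_le hq hind hXm hYm hW hX hY hmean
    _ ≤ ∫ ω, ‖X ω‖ ^ q ∂μ + q / 2 * ∫ ω, ‖X ω‖ ^ (q - 2) * ‖Y ω‖ ^ 2 ∂μ +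
          M * ∫ ω, ‖Y ω‖ ^ q ∂μ := by
        rw [← mul_assoc (2 * q ^ 2), ← mul_assoc ((2 * q + 1) ^ q)]
        gcongr
    _ = ∫ ω, (‖X ω‖ ^ q + q / 2 * (‖X ω‖ ^ (q - 2) * ‖Y ω‖ ^ 2)) ∂μ +
          M * ∫ ω, ‖Y ω‖ ^ q ∂μ := by
        rw [integral_add hXq (hsq.const_mul _), integral_const_mul]
    _ ≤ _ := by
        gcongr
        · exact hXq.add (hsq.const_mul _)
        · exact fun ω => norm_rpow_add_mul_sq_le_norm_toLp_rpow hq _ _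

end OneStep

section Multilinear

variable {Ω ι H : Type*} [NormedAddCommGroup H]

/-- The multilinear polynomial `∑_{S ⊆ s} (∏_{i ∈ S} W_i) a_S` whose coefficients `a_S` are
vectors. -/
def vecMultilin [NormedSpace ℝ H] (W : ι → Ω → ℝ) (s : Finset ι) (a : Finset ι → H) : Ω → H :=
  fun ω => ∑ S ∈ s.powerset, (∏ i ∈ S, W i ω) • a S

/-- The energy `∑_{S ⊆ R ⊆ s} ‖a_R‖²`, which for orthonormal variables is the squared `L²` norm of
the generalised derivative `D_S` of the multilinear polynomial with coefficients `a`. -/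
def derivEnergy [DecidableEq ι] (s : Finset ι) (a : Finset ι → H) (S : Finset ι) : ℝ :=
  ∑ R ∈ s.powerset with S ⊆ R, ‖a R‖ ^ 2

variable {W : ι → Ω → ℝ} {s : Finset ι}

theorem derivEnergy_nonneg [DecidableEq ι] (a : Finset ι → H) (S : Finset ι) :
    0 ≤ derivEnergy s a S :=
  Finset.sum_nonneg fun _ _ => sq_nonneg _

theorem derivEnergy_insert_of_subset [DecidableEq ι] {i : ι} (hi : i ∉ s) {S : Finset ι}
    (hS : S ⊆ s) (a : Finset ι → H) :
    derivEnergy (insert i s) a S =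
      derivEnergy s (fun R => WithLp.toLp 2 (a R, a (insert i R))) S := by
  simp only [derivEnergy, Finset.sum_filter, Finset.sum_powerset_insert hi,
    Finset.subset_insert_iff_of_notMem fun h => hi (hS h), WithLp.prod_norm_sq_eq_of_L2]
  rw [← Finset.sum_add_distrib]
  exact Finset.sum_congr rfl fun R _ => by
    split_ifs
    exacts [rfl, add_zero 0]

theorem derivEnergy_insert_insert [DecidableEq ι] {i : ι} (hi : i ∉ s) {S : Finset ι}
    (hS : S ⊆ s) (a : Finset ι → H) :
    derivEnergy (insert i s) a (insert i S) = derivEnergy s (fun R => a (insert i R)) S := by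
  simp only [derivEnergy, Finset.sum_filter, Finset.sum_powerset_insert hi,
    Finset.insert_subset_insert_iff fun h => hi (hS h)]
  rw [add_eq_right]
  exact Finset.sum_eq_zero fun R hR =>
    if_neg fun h => hi (Finset.mem_powerset.1 hR (h (Finset.mem_insert_self i S)))

section NormedSpace

variable [NormedSpace ℝ H]

theorem vecMultilin_empty (a : Finset ι → H) : vecMultilin W ∅ a = fun _ => a ∅ := by
  funext ω
  simp [vecMultilin]

theorem vecMultilin_insert [DecidableEq ι] {i : ι} (hi : i ∉ s) (a : Finset ι → H) :
    vecMultilin W (insert i s) a = fun ω =>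
      vecMultilin W s a ω + W i ω • vecMultilin W s (fun S => a (insert i S)) ω := by
  funext ω
  simp only [vecMultilin, Finset.sum_powerset_insert hi, Finset.smul_sum, smul_smul]
  congr 1
  exact Finset.sum_congr rfl fun S hS => by
    rw [Finset.prod_insert fun h => hi (Finset.mem_powerset.1 hS h)]

theorem toLp_vecMultilin (a b : Finset ι → H) (ω : Ω) :
    WithLp.toLp 2 (vecMultilin W s a ω, vecMultilin W s b ω) =
      vecMultilin W s (fun S => WithLp.toLp 2 (a S, b S)) ω := by
  simp only [vecMultilin, ← WithLp.toLp_smul, ← WithLp.toLp_sum, Prod.smul_mk, prod_mk_sum]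

theorem stronglyMeasurable_vecMultilin {m : MeasurableSpace Ω}
    (hW : ∀ i ∈ s, Measurable[m] (W i)) (a : Finset ι → H) :
    StronglyMeasurable[m] (vecMultilin W s a) :=
  Finset.stronglyMeasurable_fun_sum _ fun _ hS =>
    (Finset.stronglyMeasurable_fun_prod _ fun i hi =>
      (hW i (Finset.mem_powerset.1 hS hi)).stronglyMeasurable).smul_const _

end NormedSpace

variable [MeasurableSpace Ω] {μ : Measure Ω} {q : ℝ}

theorem exists_indep_forall_measurable (hmeas : ∀ i, Measurable (W i)) (hindep : iIndepFun W μ)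
    {i : ι} (hi : i ∉ s) :
    ∃ m : MeasurableSpace Ω, Indep (.comap (W i) inferInstance) m μ ∧
      ∀ j ∈ s, Measurable[m] (W j) := by
  refine ⟨⨆ j ∈ (s : Set ι), .comap (W j) inferInstance, ?_, fun j hj => ?_⟩
  · simpa only [Set.mem_singleton_iff, iSup_iSup_eq_left] using
      indep_iSup_of_disjoint (fun j => (hmeas j).comap_le) hindep
        (Set.disjoint_singleton_left.2 hi)
  · exact measurable_iff_comap_le.2 (le_iSup₂_of_le j hj le_rfl)

variable [IsProbabilityMeasure μ]

theorem memLp_vecMultilin [NormedSpace ℝ H] (hq : 0 < q) (hmeas : ∀ i, Measurable (W i))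
    (hindep : iIndepFun W μ) (hLq : ∀ i, MemLp (W i) (ENNReal.ofReal q) μ) (s : Finset ι)
    (a : Finset ι → H) : MemLp (vecMultilin W s a) (ENNReal.ofReal q) μ := by
  classical
  induction s using Finset.induction_on generalizing a with
  | empty => simpa only [vecMultilin_empty] using memLp_const (a ∅)
  | insert i s hi ih =>
    obtain ⟨m, hind, hm⟩ := exists_indep_forall_measurable hmeas hindep hi
    rw [vecMultilin_insert hi]
    exact (ih a).add (memLp_smul_of_indep hq hind (stronglyMeasurable_vecMultilin hm _) (hLq i)
      (ih _))

theorem memLp_two_vecMultilin [NormedSpace ℝ H] (hmeas : ∀ i, Measurable (W i))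
    (hindep : iIndepFun W μ) (hL2 : ∀ i, MemLp (W i) 2 μ) (s : Finset ι) (a : Finset ι → H) :
    MemLp (vecMultilin W s a) 2 μ := by
  rw [← ENNReal.ofReal_ofNat] at hL2 ⊢
  exact memLp_vecMultilin two_pos hmeas hindep hL2 s a

variable [InnerProductSpace ℝ H]

theorem integral_norm_vecMultilin_sq (hmeas : ∀ i, Measurable (W i)) (hindep : iIndepFun W μ)
    (hL2 : ∀ i, MemLp (W i) 2 μ) (hmean : ∀ i, ∫ ω, W i ω ∂μ = 0)
    (hvar : ∀ i, ∫ ω, W i ω ^ 2 ∂μ = 1) (s : Finset ι) (a : Finset ι → H) :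
    ∫ ω, ‖vecMultilin W s a ω‖ ^ 2 ∂μ = ∑ S ∈ s.powerset, ‖a S‖ ^ 2 := by
  classical
  have hLp := memLp_two_vecMultilin (H := H) hmeas hindep hL2
  induction s using Finset.induction_on generalizing a with
  | empty => simp [vecMultilin_empty]
  | insert i s hi ih =>
    obtain ⟨m, hind, hm⟩ := exists_indep_forall_measurable hmeas hindep hi
    rw [vecMultilin_insert hi, integral_norm_add_smul_sq hind
      (stronglyMeasurable_vecMultilin hm _) (stronglyMeasurable_vecMultilin hm _) (hL2 i)
      (hLp s _) (hLp s _) (hmean i), ih, ih, hvar, one_mul, Finset.sum_powerset_insert hi]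

theorem integral_norm_vecMultilin_rpow_le [DecidableEq ι] {M : ι → ℝ} (hq : 2 ≤ q)
    (hmeas : ∀ i, Measurable (W i)) (hindep : iIndepFun W μ)
    (hLq : ∀ i, MemLp (W i) (ENNReal.ofReal q) μ) (hmean : ∀ i, ∫ ω, W i ω ∂μ = 0)
    (hvar : ∀ i, 4 * q * ∫ ω, W i ω ^ 2 ∂μ ≤ 1)
    (hM : ∀ i, (2 * q + 1) ^ q * ∫ ω, |W i ω| ^ q ∂μ ≤ M i) (s : Finset ι) (a : Finset ι → H) :
    ∫ ω, ‖vecMultilin W s a ω‖ ^ q ∂μ ≤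
      ∑ S ∈ s.powerset, (∏ i ∈ S, M i) * derivEnergy s a S ^ (q / 2) := by
  have hM_nonneg (i : ι) : 0 ≤ M i := le_trans (by positivity) (hM i)
  -- The space of coefficients varies in the induction: `H` becomes `H × H` at every step.
  induction s using Finset.induction_on generalizing H with
  | empty => simp [vecMultilin_empty, derivEnergy, sq_rpow_half]
  | insert i s hi ih =>
    have hLp (a : Finset ι → H) : MemLp (vecMultilin W s a) (ENNReal.ofReal q) μ :=
      memLp_vecMultilin (by linarith) hmeas hindep hLq s a
    obtain ⟨m, hind, hm⟩ := exists_indep_forall_measurable hmeas hindep hi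
    have hstep := integral_norm_add_smul_rpow_le_toLp hq hind (stronglyMeasurable_vecMultilin hm a)
      (stronglyMeasurable_vecMultilin hm fun S => a (insert i S)) (hLq i) (hLp _) (hLp _)
      (hmean i) (hvar i) (hM i)
    simp only [toLp_vecMultilin] at hstep
    rw [vecMultilin_insert hi, Finset.sum_powerset_insert hi]
    refine hstep.trans (add_le_add ((ih _).trans_eq ?_) ?_)
    · exact Finset.sum_congr rfl fun S hS => by
        rw [derivEnergy_insert_of_subset hi (Finset.mem_powerset.1 hS)]
    · refine (mul_le_mul_of_nonneg_left (ih _) (hM_nonneg i)).trans_eq ?_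
      rw [Finset.mul_sum]
      refine Finset.sum_congr rfl fun S hS => ?_
      rw [derivEnergy_insert_insert hi (Finset.mem_powerset.1 hS),
        Finset.prod_insert fun h => hi (Finset.mem_powerset.1 hS h), mul_assoc]

end Multilinear

section Damping

variable {ι H : Type*} [NormedAddCommGroup H] [NormedSpace ℝ H] {s : Finset ι}

/-- The coefficients of `T_ρ f` with `ρ = 1 / √2`. This `ρ` is chosen because then
`∑_{S ⊆ R} ρ ^ (2 |R|) = 1`. -/
noncomputable def damp (a : Finset ι → H) (S : Finset ι) : H :=
  (√2)⁻¹ ^ S.card • a S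

theorem norm_damp_sq (a : Finset ι → H) (S : Finset ι) :
    ‖damp a S‖ ^ 2 = (1 / 2) ^ S.card * ‖a S‖ ^ 2 := by
  rw [damp, norm_smul, mul_pow, Real.norm_of_nonneg (by positivity), ← pow_mul, mul_comm S.card,
    pow_mul, inv_pow, Real.sq_sqrt zero_le_two, one_div]

variable [DecidableEq ι]

theorem derivEnergy_damp_le (a : Finset ι → H) (S : Finset ι) :
    derivEnergy s (damp a) S ≤ derivEnergy s a S := by
  refine Finset.sum_le_sum fun R _ => ?_
  rw [norm_damp_sq]
  exact mul_le_of_le_one_left (sq_nonneg _) (pow_le_one₀ (by norm_num) (by norm_num))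

theorem sum_derivEnergy_damp (s : Finset ι) (a : Finset ι → H) :
    ∑ S ∈ s.powerset, derivEnergy s (damp a) S = derivEnergy s a ∅ := by
  simp only [derivEnergy, Finset.empty_subset, Finset.filter_true]
  rw [Finset.sum_comm' (t' := s.powerset) (s' := fun R => R.powerset) fun S R => by
    simp only [Finset.mem_filter, Finset.mem_powerset]
    exact ⟨fun h => ⟨h.2.2, h.2.1⟩, fun h => ⟨h.1.trans h.2, h.2, h.1⟩⟩]
  refine Finset.sum_congr rfl fun R _ => ?_
  rw [Finset.sum_const, Finset.card_powerset, norm_damp_sq, nsmul_eq_mul, ← mul_assoc,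
    Nat.cast_pow, Nat.cast_ofNat, ← mul_pow, mul_one_div_cancel two_ne_zero, one_pow, one_mul]

theorem sum_rpow_two_sub_mul_derivEnergy_damp_le {q B : ℝ} (hq : 2 ≤ q) (hB : 0 ≤ B)
    {t : Finset ι → ℝ} (ht : ∀ S, 0 < t S) {a : Finset ι → H}
    (h : ∀ S, derivEnergy s a S ≤ B * t S ^ 2) :
    ∑ S ∈ s.powerset, t S ^ (2 - q) * derivEnergy s (damp a) S ^ (q / 2) ≤
      B ^ ((q - 2) / 2) * derivEnergy s a ∅ := by
  rw [← sum_derivEnergy_damp, Finset.mul_sum]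
  exact Finset.sum_le_sum fun S _ => rpow_two_sub_mul_rpow_half_le hq (derivEnergy_nonneg _ S)
    (ht S) hB ((derivEnergy_damp_le a S).trans (h S))

end Damping

section ENorm

variable {Ω E : Type*} [MeasurableSpace Ω] {μ : Measure Ω} [NormedAddCommGroup E] {f : Ω → E}

theorem eLpNorm_ofReal_rpow {q : ℝ} (hq : 0 < q) (hf : MemLp f (ENNReal.ofReal q) μ) :
    eLpNorm f (ENNReal.ofReal q) μ ^ q = ENNReal.ofReal (∫ ω, ‖f ω‖ ^ q ∂μ) := by
  rw [hf.eLpNorm_eq_integral_rpow_norm (ENNReal.ofReal_pos.2 hq).ne' ENNReal.ofReal_ne_top,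
    ENNReal.toReal_ofReal hq.le, ENNReal.ofReal_rpow_of_nonneg (by positivity) hq.le,
    Real.rpow_inv_rpow (by positivity) hq.ne']

theorem eLpNorm_two_sq (hf : MemLp f 2 μ) :
    eLpNorm f 2 μ ^ 2 = ENNReal.ofReal (∫ ω, ‖f ω‖ ^ 2 ∂μ) := by
  simpa only [ENNReal.ofReal_ofNat, ENNReal.rpow_two, Real.rpow_two] using
    eLpNorm_ofReal_rpow two_pos (by simpa only [ENNReal.ofReal_ofNat] using hf)

theorem rpow_eq_ofReal_rpow_half {x : ℝ≥0∞} {y q : ℝ} (hq : 0 ≤ q) (hy : 0 ≤ y)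
    (h : x ^ 2 = ENNReal.ofReal y) : x ^ q = ENNReal.ofReal (y ^ (q / 2)) := by
  rw [← ENNReal.ofReal_rpow_of_nonneg hy (by positivity), ← h, ← ENNReal.rpow_two,
    ← ENNReal.rpow_mul, mul_div_cancel₀ q two_ne_zero]

end ENorm

section Reindexing

variable {ι : Type*} [Fintype ι] [DecidableEq ι]

theorem sum_filter_subset_eq_sum_powerset_compl {M : Type*} [AddCommMonoid M] (S : Finset ι)
    (f : Finset ι → M) : ∑ R with S ⊆ R, f R = ∑ T ∈ Sᶜ.powerset, f (S ∪ T) := by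
  refine Finset.sum_bij' (fun R _ => R \ S) (fun T _ => S ∪ T) ?_ ?_ ?_ ?_ ?_ <;>
    simp only [Finset.mem_filter_univ, Finset.mem_powerset]
  · exact fun R _ => Finset.subset_compl_iff_disjoint_left.2 Finset.disjoint_sdiff
  · exact fun T _ => Finset.subset_union_left
  · exact fun R hR => Finset.union_sdiff_of_subset hR
  · exact fun T hT => Finset.union_sdiff_cancel_left (Finset.subset_compl_iff_disjoint_left.1 hT)
  · exact fun R hR => by rw [Finset.union_sdiff_of_subset hR]

theorem derivEnergy_univ {H : Type*} [NormedAddCommGroup H] (a : Finset ι → H) (S : Finset ι) :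
    derivEnergy Finset.univ a S = ∑ T ∈ Sᶜ.powerset, ‖a (S ∪ T)‖ ^ 2 := by
  rw [derivEnergy, Finset.powerset_univ, sum_filter_subset_eq_sum_powerset_compl]

end Reindexing

section Noise

variable {Ω : Type*} {n : ℕ} {Z : Fin n → Ω → ℝ}

theorem noise_eq_vecMultilin (ρ : ℝ) (a : Finset (Fin n) → ℝ) :
    noise ρ Z a = vecMultilin (fun i ω => ρ * Z i ω) Finset.univ a := by
  funext ω
  simp only [noise, vecMultilin, Finset.powerset_univ, Finset.prod_mul_distrib,
    Finset.prod_const, smul_eq_mul, mul_right_comm]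

theorem noise_eq_noise_damp (ρ : ℝ) (a : Finset (Fin n) → ℝ) :
    noise ρ Z a = noise (√2 * ρ) Z (damp a) := by
  funext ω
  refine Finset.sum_congr rfl fun S _ => ?_
  rw [damp, smul_eq_mul, ← mul_assoc ((√2 * ρ) ^ S.card), ← mul_pow, mul_right_comm √2,
    mul_inv_cancel₀ (by positivity), one_mul]

theorem genDeriv_eq_vecMultilin (S : Finset (Fin n)) (a : Finset (Fin n) → ℝ) :
    genDeriv S Z a = vecMultilin Z Sᶜ fun T => a (S ∪ T) := by
  funext ω
  rw [genDeriv, vecMultilin, sum_filter_subset_eq_sum_powerset_compl]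
  refine Finset.sum_congr rfl fun T hT => ?_
  rw [Finset.union_sdiff_cancel_left
    (Finset.subset_compl_iff_disjoint_left.1 (Finset.mem_powerset.1 hT)), smul_eq_mul, mul_comm]

theorem genDeriv_empty (a : Finset (Fin n) → ℝ) : genDeriv ∅ Z a = multilin Z a := by
  funext ω
  simp only [genDeriv, multilin, Finset.empty_subset, Finset.filter_true, Finset.sdiff_empty]

variable [MeasurableSpace Ω] {μ : Measure Ω} [IsProbabilityMeasure μ]

theorem eLpNorm_genDeriv_sq (hmeas : ∀ i, Measurable (Z i)) (hindep : iIndepFun Z μ)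
    (hL2 : ∀ i, MemLp (Z i) 2 μ) (hmean : ∀ i, ∫ ω, Z i ω ∂μ = 0)
    (hvar : ∀ i, ∫ ω, Z i ω ^ 2 ∂μ = 1) (a : Finset (Fin n) → ℝ) (S : Finset (Fin n)) :
    eLpNorm (genDeriv S Z a) 2 μ ^ 2 = ENNReal.ofReal (derivEnergy Finset.univ a S) := by
  rw [genDeriv_eq_vecMultilin, eLpNorm_two_sq (memLp_two_vecMultilin hmeas hindep hL2 _ _),
    integral_norm_vecMultilin_sq hmeas hindep hL2 hmean hvar, derivEnergy_univ]

theorem derivEnergy_le_of_genInfluence_le {β : ℝ} (hβ : 0 ≤ β)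
    (hmeas : ∀ i, Measurable (Z i)) (hindep : iIndepFun Z μ)
    (hL2 : ∀ i, MemLp (Z i) 2 μ) (hmean : ∀ i, ∫ ω, Z i ω ∂μ = 0)
    (hvar : ∀ i, ∫ ω, Z i ω ^ 2 ∂μ = 1) {σ : Fin n → ℝ} (hσ : ∀ i, 0 < σ i)
    {a : Finset (Fin n) → ℝ} {S : Finset (Fin n)}
    (hinf : genInfluence μ σ S Z a ≤ ENNReal.ofReal β * eLpNorm (multilin Z a) 2 μ ^ 2) :
    derivEnergy Finset.univ a S ≤
      β * derivEnergy Finset.univ a ∅ * (∏ i ∈ S, σ i) ^ 2 := by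
  have hparseval := eLpNorm_genDeriv_sq hmeas hindep hL2 hmean hvar a
  have hσS : 0 < ∏ i ∈ S, σ i := Finset.prod_pos fun i _ => hσ i
  have hhom : eLpNorm (fun ω => (∏ i ∈ S, σ i)⁻¹ * genDeriv S Z a ω) 2 μ =
      ‖(∏ i ∈ S, σ i)⁻¹‖ₑ * eLpNorm (genDeriv S Z a) 2 μ :=
    eLpNorm_const_smul (∏ i ∈ S, σ i)⁻¹ (genDeriv S Z a) 2 μ
  have hN : 0 ≤ derivEnergy Finset.univ a ∅ := derivEnergy_nonneg a ∅
  rw [genInfluence, hhom, mul_pow, hparseval, ← genDeriv_empty, hparseval,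
    Real.enorm_eq_ofReal (inv_pos.2 hσS).le, ← ENNReal.ofReal_pow (inv_pos.2 hσS).le,
    ← ENNReal.ofReal_mul (by positivity), ← ENNReal.ofReal_mul hβ,
    ENNReal.ofReal_le_ofReal_iff (by positivity), inv_pow,
    inv_mul_le_iff₀ (pow_pos hσS 2)] at hinf
  rwa [mul_comm] at hinf

theorem eLpNorm_noise_rpow_le {q ρ : ℝ} (hq : 2 ≤ q) (hρ : (2 * q + 1) * |ρ| ≤ 1)
    (hmeas : ∀ i, Measurable (Z i)) (hindep : iIndepFun Z μ)
    (hLq : ∀ i, MemLp (Z i) (ENNReal.ofReal q) μ) (hmean : ∀ i, ∫ ω, Z i ω ∂μ = 0)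
    (hvar : ∀ i, ∫ ω, Z i ω ^ 2 ∂μ = 1) {σ : Fin n → ℝ} (hσ : ∀ i, 0 ≤ σ i)
    (hσq : ∀ i, ∫ ω, |Z i ω| ^ q ∂μ ≤ σ i ^ (2 - q)) (a : Finset (Fin n) → ℝ) :
    eLpNorm (noise ρ Z a) (ENNReal.ofReal q) μ ^ q ≤
      ENNReal.ofReal (∑ S, (∏ i ∈ S, σ i) ^ (2 - q) * derivEnergy Finset.univ a S ^ (q / 2)) := by
  have hmeas' (i : Fin n) : Measurable fun ω => ρ * Z i ω := (hmeas i).const_mul ρ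
  have hindep' : iIndepFun (fun i ω => ρ * Z i ω) μ :=
    hindep.comp (fun _ z => ρ * z) fun _ => measurable_const_mul ρ
  have hLq' (i : Fin n) : MemLp (fun ω => ρ * Z i ω) (ENNReal.ofReal q) μ := (hLq i).const_mul ρ
  have hmean' (i : Fin n) : ∫ ω, ρ * Z i ω ∂μ = 0 := by
    rw [integral_const_mul, hmean, mul_zero]
  have hvar' (i : Fin n) : 4 * q * ∫ ω, (ρ * Z i ω) ^ 2 ∂μ ≤ 1 := by
    simp only [mul_pow, integral_const_mul, hvar]
    have := pow_le_one₀ (by positivity) hρ (n := 2)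
    rw [mul_pow, sq_abs] at this
    nlinarith [sq_nonneg ρ, mul_nonneg (sq_nonneg (2 * q)) (sq_nonneg ρ)]
  have hM (i : Fin n) : (2 * q + 1) ^ q * ∫ ω, |ρ * Z i ω| ^ q ∂μ ≤ σ i ^ (2 - q) := by
    simp only [abs_mul, Real.mul_rpow (abs_nonneg _) (abs_nonneg _), integral_const_mul]
    rw [← mul_assoc, ← Real.mul_rpow (by positivity) (abs_nonneg ρ)]
    exact (mul_le_of_le_one_left (by positivity)
      (Real.rpow_le_one (by positivity) hρ (by linarith))).trans (hσq i)
  rw [noise_eq_vecMultilin, eLpNorm_ofReal_rpow (by linarith)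
    (memLp_vecMultilin (by linarith) hmeas' hindep' hLq' _ a)]
  simpa only [Finset.powerset_univ, Real.finsetProd_rpow _ _ fun i _ => hσ i] using
    ENNReal.ofReal_le_ofReal
      (integral_norm_vecMultilin_rpow_le hq hmeas' hindep' hLq' hmean' hvar' hM Finset.univ a)

theorem eLpNorm_noise_rpow_le_sum_genDeriv {q ρ : ℝ} (hq : 2 ≤ q) (hρ : (2 * q + 1) * |ρ| ≤ 1)
    (hmeas : ∀ i, Measurable (Z i)) (hindep : iIndepFun Z μ)
    (hLq : ∀ i, MemLp (Z i) (ENNReal.ofReal q) μ) (hmean : ∀ i, ∫ ω, Z i ω ∂μ = 0)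
    (hvar : ∀ i, ∫ ω, Z i ω ^ 2 ∂μ = 1) {σ : Fin n → ℝ} (hσ : ∀ i, 0 ≤ σ i)
    (hσq : ∀ i, ∫ ω, |Z i ω| ^ q ∂μ ≤ σ i ^ (2 - q)) (a : Finset (Fin n) → ℝ) :
    eLpNorm (noise ρ Z a) (ENNReal.ofReal q) μ ^ q ≤
      ∑ S : Finset (Fin n), ENNReal.ofReal ((∏ i ∈ S, σ i) ^ (2 - q)) *
        eLpNorm (genDeriv S Z a) 2 μ ^ q := by
  have hσS (S : Finset (Fin n)) : 0 ≤ (∏ i ∈ S, σ i) ^ (2 - q) :=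
    Real.rpow_nonneg (Finset.prod_nonneg fun i _ => hσ i) _
  have henergy (S : Finset (Fin n)) : 0 ≤ derivEnergy Finset.univ a S ^ (q / 2) :=
    Real.rpow_nonneg (derivEnergy_nonneg a S) _
  refine (eLpNorm_noise_rpow_le hq hρ hmeas hindep hLq hmean hvar hσ hσq a).trans_eq ?_
  rw [ENNReal.ofReal_sum_of_nonneg fun S _ => mul_nonneg (hσS S) (henergy S)]
  refine Finset.sum_congr rfl fun S _ => ?_
  rw [ENNReal.ofReal_mul (hσS S), rpow_eq_ofReal_rpow_half (by linarith) (derivEnergy_nonneg a S)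
    (eLpNorm_genDeriv_sq hmeas hindep (fun i => memLp_two_of_two_le hq (hLq i)) hmean hvar a S)]

theorem eLpNorm_noise_le_of_genInfluence_le {q ρ β : ℝ} (hq : 2 ≤ q)
    (hρ : √2 * ((2 * q + 1) * |ρ|) ≤ 1) (hβ : 0 ≤ β)
    (hmeas : ∀ i, Measurable (Z i)) (hindep : iIndepFun Z μ)
    (hLq : ∀ i, MemLp (Z i) (ENNReal.ofReal q) μ) (hmean : ∀ i, ∫ ω, Z i ω ∂μ = 0)
    (hvar : ∀ i, ∫ ω, Z i ω ^ 2 ∂μ = 1) {σ : Fin n → ℝ} (hσ : ∀ i, 0 < σ i)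
    (hσq : ∀ i, ∫ ω, |Z i ω| ^ q ∂μ ≤ σ i ^ (2 - q)) {a : Finset (Fin n) → ℝ}
    (hinf : ∀ S, genInfluence μ σ S Z a ≤
      ENNReal.ofReal β * eLpNorm (multilin Z a) 2 μ ^ 2) :
    eLpNorm (noise ρ Z a) (ENNReal.ofReal q) μ ≤
      ENNReal.ofReal (β ^ ((q - 2) / (2 * q))) * eLpNorm (multilin Z a) 2 μ := by
  have hq₀ : 0 < q := by linarith
  have hL2 (i : Fin n) : MemLp (Z i) 2 μ := memLp_two_of_two_le hq (hLq i)
  have hρ' : (2 * q + 1) * |√2 * ρ| ≤ 1 := by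
    rwa [abs_mul, abs_of_nonneg (Real.sqrt_nonneg 2), mul_left_comm]
  set N := derivEnergy Finset.univ a ∅
  have hN₀ : 0 ≤ N := derivEnergy_nonneg a ∅
  have hf : eLpNorm (multilin Z a) 2 μ ^ q = ENNReal.ofReal (N ^ (q / 2)) := by
    rw [← genDeriv_empty]
    exact rpow_eq_ofReal_rpow_half hq₀.le hN₀
      (eLpNorm_genDeriv_sq hmeas hindep hL2 hmean hvar a ∅)
  have hconst : ENNReal.ofReal (β ^ ((q - 2) / (2 * q))) ^ q =
      ENNReal.ofReal (β ^ ((q - 2) / 2)) := by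
    rw [ENNReal.ofReal_rpow_of_nonneg (by positivity) hq₀.le, ← Real.rpow_mul hβ]
    congr 2; field_simp
  rw [← ENNReal.rpow_le_rpow_iff hq₀, ENNReal.mul_rpow_of_nonneg _ _ hq₀.le, hconst, hf,
    ← ENNReal.ofReal_mul (by positivity), noise_eq_noise_damp]
  refine (eLpNorm_noise_rpow_le hq hρ' hmeas hindep hLq hmean hvar (fun i => (hσ i).le) hσq
    (damp a)).trans (ENNReal.ofReal_le_ofReal ?_)
  calc ∑ S, (∏ i ∈ S, σ i) ^ (2 - q) * derivEnergy Finset.univ (damp a) S ^ (q / 2)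
      ≤ (β * N) ^ ((q - 2) / 2) * N := by
        rw [← Finset.powerset_univ]
        exact sum_rpow_two_sub_mul_derivEnergy_damp_le hq (by positivity)
          (fun S => Finset.prod_pos fun i _ => hσ i) fun S =>
            derivEnergy_le_of_genInfluence_le hβ hmeas hindep hL2 hmean hvar hσ (hinf S)
    _ = β ^ ((q - 2) / 2) * N ^ (q / 2) := by
        rw [Real.mul_rpow hβ hN₀, mul_assoc, ← Real.rpow_add_one' hN₀ (by linarith)]
        congr 2; ring

end Noise

section NoiseRange

variable {q ρ : ℝ}

theorem two_mul_add_one_mul_abs_le_one (hq : 2 ≤ q) (hρ : |ρ| ≤ 1 / (2 * q ^ (3 / 2 : ℝ))) :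
    (2 * q + 1) * |ρ| ≤ 1 :=
  calc (2 * q + 1) * |ρ| ≤ 2 * q ^ (3 / 2 : ℝ) * (1 / (2 * q ^ (3 / 2 : ℝ))) := by
        gcongr; exact two_mul_add_one_le_two_mul_rpow hq
    _ = 1 := mul_one_div_cancel (by positivity)

theorem sqrt_two_mul_two_mul_rpow_neg (hq : 0 ≤ q) :
    √2 * (2 * q) ^ (-(3 / 2) : ℝ) = 1 / (2 * q ^ (3 / 2 : ℝ)) := by
  have hpow : (2 : ℝ) ^ (-(3 / 2) : ℝ) = 2 ^ (-1 - 1 / 2 : ℝ) := by norm_num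
  rw [Real.mul_rpow zero_le_two hq, hpow, Real.rpow_sub two_pos, Real.rpow_neg_one,
    ← Real.sqrt_eq_rpow, Real.rpow_neg hq]
  field_simp

theorem sqrt_two_mul_two_mul_add_one_mul_abs_le_one (hq : 2 ≤ q)
    (hρ : |ρ| ≤ (2 * q) ^ (-(3 / 2) : ℝ)) : √2 * ((2 * q + 1) * |ρ|) ≤ 1 := by
  have hsqrt : |√2 * ρ| = √2 * |ρ| := by rw [abs_mul, abs_of_nonneg (Real.sqrt_nonneg 2)]
  rw [mul_left_comm, ← hsqrt]
  refine two_mul_add_one_mul_abs_le_one hq ?_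
  rw [hsqrt, ← sqrt_two_mul_two_mul_rpow_neg (by linarith)]
  gcongr

end NoiseRange

end GenHyper

theorem mainTheorem9_general {Ω : Type*} [MeasurableSpace Ω] (μ : Measure Ω)
    [IsProbabilityMeasure μ] (n : ℕ) (q : ℝ) (hq : 2 ≤ q) (Z : Fin n → Ω → ℝ)
    (hmeas : ∀ i, Measurable (Z i)) (hindep : iIndepFun Z μ)
    (hLq : ∀ i, MemLp (Z i) (ENNReal.ofReal q) μ) (hmean : ∀ i, ∫ ω, Z i ω ∂μ = 0)
    (hvar : ∀ i, ∫ ω, Z i ω ^ 2 ∂μ = 1) (a : Finset (Fin n) → ℝ) (σ : Fin n → ℝ)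
    (hσ : ∀ i, 0 < σ i) (hσq : ∀ i, ∫ ω, |Z i ω| ^ q ∂μ ≤ σ i ^ (2 - q)) :
    (∀ ρ : ℝ, (2 * q + 1) * |ρ| ≤ 1 →
      eLpNorm (GenHyper.noise ρ Z a) (ENNReal.ofReal q) μ ^ q ≤
        ∑ S : Finset (Fin n), ENNReal.ofReal ((∏ i ∈ S, σ i) ^ (2 - q)) *
          eLpNorm (GenHyper.genDeriv S Z a) 2 μ ^ q) ∧
    (∀ ρ β : ℝ, √2 * ((2 * q + 1) * |ρ|) ≤ 1 → 0 ≤ β →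
      (∀ S : Finset (Fin n), GenHyper.genInfluence μ σ S Z a ≤
        ENNReal.ofReal β * eLpNorm (GenHyper.multilin Z a) 2 μ ^ 2) →
      eLpNorm (GenHyper.noise ρ Z a) (ENNReal.ofReal q) μ ≤
        ENNReal.ofReal (β ^ ((q - 2) / (2 * q))) * eLpNorm (GenHyper.multilin Z a) 2 μ) :=
  ⟨fun _ hρ => GenHyper.eLpNorm_noise_rpow_le_sum_genDeriv hq hρ hmeas hindep hLq hmean hvar
      (fun i => (hσ i).le) hσq a,
    fun _ _ hρ hβ => GenHyper.eLpNorm_noise_le_of_genInfluence_le hq hρ hβ hmeas hindep hLq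
      hmean hvar hσ hσq⟩

theorem mainTheorem9 {Ω : Type*} [MeasurableSpace Ω] (μ : Measure Ω) [IsProbabilityMeasure μ]
    (n : ℕ) (q : ℝ) (hq : 2 ≤ q) (Z : Fin n → Ω → ℝ)
    (hmeas : ∀ i, Measurable (Z i))
    (hindep : iIndepFun Z μ)
    (hLq : ∀ i, MemLp (Z i) (ENNReal.ofReal q) μ)
    (hmean : ∀ i, ∫ ω, Z i ω ∂μ = 0)
    (hvar : ∀ i, ∫ ω, Z i ω ^ 2 ∂μ = 1)
    (a : Finset (Fin n) → ℝ) :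
    -- a common bound on the `q`-th moments
    (∀ σ : ℝ, 0 < σ → (∀ i, ∫ ω, |Z i ω| ^ q ∂μ ≤ σ ^ (2 - q)) →
      (∀ ρ : ℝ, |ρ| < 1 / (2 * q ^ (3 / 2 : ℝ)) →
        eLpNorm (GenHyper.noise ρ Z a) (ENNReal.ofReal q) μ ^ q ≤
          ∑ S : Finset (Fin n), ENNReal.ofReal (σ ^ ((2 - q) * (S.card : ℝ))) *
            eLpNorm (GenHyper.genDeriv S Z a) 2 μ ^ q) ∧
      (∀ ρ β : ℝ, |ρ| ≤ (2 * q) ^ (-(3 / 2) : ℝ) → 0 < β →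
        (∀ S : Finset (Fin n), GenHyper.genInfluence μ (fun _ => σ) S Z a ≤
          ENNReal.ofReal β * eLpNorm (GenHyper.multilin Z a) 2 μ ^ 2) →
        eLpNorm (GenHyper.noise ρ Z a) (ENNReal.ofReal q) μ ≤
          ENNReal.ofReal (β ^ ((q - 2) / (2 * q))) *
            eLpNorm (GenHyper.multilin Z a) 2 μ)) ∧
    -- individual bounds on the `q`-th moments
    (∀ σ : Fin n → ℝ, (∀ i, 0 < σ i) → (∀ i, ∫ ω, |Z i ω| ^ q ∂μ ≤ σ i ^ (2 - q)) →
      (∀ ρ : ℝ, |ρ| ≤ (2 * q) ^ (-(3 / 2) : ℝ) →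
        eLpNorm (GenHyper.noise ρ Z a) (ENNReal.ofReal q) μ ^ q ≤
          ∑ S : Finset (Fin n), ENNReal.ofReal ((∏ i ∈ S, σ i) ^ (2 - q)) *
            eLpNorm (GenHyper.genDeriv S Z a) 2 μ ^ q) ∧
      (∀ ρ β : ℝ, |ρ| ≤ (2 * q) ^ (-(3 / 2) : ℝ) → 0 < β →
        (∀ S : Finset (Fin n), GenHyper.genInfluence μ σ S Z a ≤
          ENNReal.ofReal β * eLpNorm (GenHyper.multilin Z a) 2 μ ^ 2) →
        eLpNorm (GenHyper.noise ρ Z a) (ENNReal.ofReal q) μ ≤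
          ENNReal.ofReal (β ^ ((q - 2) / (2 * q))) *
            eLpNorm (GenHyper.multilin Z a) 2 μ)) := by
  have general := mainTheorem9_general μ n q hq Z hmeas hindep hLq hmean hvar a
  have hsmall {ρ : ℝ} (hρ : |ρ| ≤ (2 * q) ^ (-(3 / 2) : ℝ)) : √2 * ((2 * q + 1) * |ρ|) ≤ 1 :=
    GenHyper.sqrt_two_mul_two_mul_add_one_mul_abs_le_one hq hρ
  constructor
  · intro σ hσ hσq
    obtain ⟨hnoise, hinfluence⟩ := general (fun _ => σ) (fun _ => hσ) hσq
    refine ⟨fun ρ hρ => ?_, fun ρ β hρ hβ => hinfluence ρ β (hsmall hρ) hβ.le⟩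
    simpa only [Finset.prod_const, ← Real.rpow_natCast_mul hσ.le, mul_comm (2 - q)] using
      hnoise ρ (GenHyper.two_mul_add_one_mul_abs_le_one hq hρ.le)
  · intro σ hσ hσq
    obtain ⟨hnoise, hinfluence⟩ := general σ hσ hσq
    refine ⟨fun ρ hρ => hnoise ρ ?_, fun ρ β hρ hβ => hinfluence ρ β (hsmall hρ) hβ.le⟩
    exact (le_mul_of_one_le_left (by positivity) (Real.one_le_sqrt.2 one_le_two)).trans
      (hsmall hρ)
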